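/- Conventions. An ideal on a set $S$ is a family of subsets of $S$ closed under subsets and finite unions and containing all singletons; a $\sigma$-ideal on $S$ is moreover closed under countable unions. The ideal is proper if $S$ itself is not in it. The $\sigma$-ideal generated by a family $\mathcal F$ of subsets of $S$ is the smallest $\sigma$-ideal on $S$ containing $\mathcal F$. Let $J$ be an ideal on a countable set $E$, let $X$ be a topological space and let $I$ be a $\sigma$-ideal on $X$. We say that $J$ is represented on $X$ by $I$ if there are a countable dense set $D\subseteq X$ and a bijection $\rho:E\to D$ such that for every $a\subseteq E$: $a\in J$ if and only if $\mathrm{cl}_X(\rho(a))\in I$. We say that $J$ has a topological representation if it is represented by some $\sigma$-ideal on some separable metrizable space. Theorem. Let $J$ be a proper ideal on a countable set $E$. If $J$ has a topological representation, then there is a family $\mathcal F$ of compact nowhere dense subsets of the Cantor space $2^{\omega}$ such that $J$ is represented on $2^{\omega}$ by the $\sigma$-ideal generated by $\mathcal F$. -/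

import Mathlib

open Set

universe v u

/-- `J` is an ideal of subsets of `S`: it is closed under subsets and finite unions, and it contains
all singletons. Properness (`univ ∉ J`) is not part of the definition. -/
structure IsSetIdeal {S : Type*} (J : Set (Set S)) : Prop where
  empty_mem : ∅ ∈ J
  mem_of_subset : ∀ ⦃a b : Set S⦄, a ⊆ b → b ∈ J → a ∈ J
  union_mem : ∀ ⦃a b : Set S⦄, a ∈ J → b ∈ J → a ∪ b ∈ J
  singleton_mem : ∀ s : S, {s} ∈ J

/-- `I` is a `σ`-ideal of subsets of `S`: it is closed under subsets and countable unions, and it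
contains all singletons (and the empty set). -/
structure IsSetSigmaIdeal {S : Type*} (I : Set (Set S)) : Prop where
  empty_mem : ∅ ∈ I
  mem_of_subset : ∀ ⦃A B : Set S⦄, A ⊆ B → B ∈ I → A ∈ I
  iUnion_mem : ∀ A : ℕ → Set S, (∀ n, A n ∈ I) → (⋃ n, A n) ∈ I
  singleton_mem : ∀ s : S, {s} ∈ I

/-- The `σ`-ideal generated by a family `F` of subsets of `S`: the least `σ`-ideal containing `F`. -/
def generatedSigmaIdeal {S : Type*} (F : Set (Set S)) : Set (Set S) :=
  {A | ∀ I : Set (Set S), IsSetSigmaIdeal I → F ⊆ I → A ∈ I}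

theorem isSetSigmaIdeal_generatedSigmaIdeal {S : Type*} (F : Set (Set S)) :
    IsSetSigmaIdeal (generatedSigmaIdeal F) where
  empty_mem := fun _ hI _ => hI.empty_mem
  mem_of_subset := fun _ _ hAB hB I hI hF => hI.mem_of_subset hAB (hB I hI hF)
  iUnion_mem := fun A hA I hI hF => hI.iUnion_mem A fun n => hA n I hI hF
  singleton_mem := fun s _ hI _ => hI.singleton_mem s

/-- The family `J_I` of those subsets of `D` whose closure in `X` belongs to `I`. -/
def closureIdeal {X : Type*} [TopologicalSpace X] (I : Set (Set X)) (D : Set X) : Set (Set X) :=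
  {a | a ⊆ D ∧ closure a ∈ I}

/-- The family `J` of subsets of `E` is represented on the space `X` by the `σ`-ideal `I`: for some
countable dense `D ⊆ X` and some bijection `ρ` from `E` onto `D`, a set `a ⊆ E` is in `J` exactly
when `ρ '' a` is a subset of `D` whose closure belongs to `I`. -/
def IsRepresentedBy {E X : Type*} [TopologicalSpace X] (J : Set (Set E)) (I : Set (Set X)) : Prop :=
  IsSetSigmaIdeal I ∧
    ∃ D : Set X, D.Countable ∧ Dense D ∧
      ∃ ρ : E → X, BijOn ρ univ D ∧ J = {a : Set E | ρ '' a ∈ closureIdeal I D}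

/-- `J` has a topological representation: it is represented by some `σ`-ideal on some separable
metrizable space. The universe `v` of the space is arbitrary. -/
def HasTopologicalRepresentation {E : Type u} (J : Set (Set E)) : Prop :=
  ∃ (X : Type v) (_ : TopologicalSpace X) (_ : TopologicalSpace.MetrizableSpace X)
    (_ : TopologicalSpace.SeparableSpace X) (I : Set (Set X)), IsRepresentedBy J I

/-!
Let `ρ : E → X` represent `J` by `I`, and let `f : E → 2^ω` record to which members of a countable
base of `X` the point `ρ e` belongs. Two traces of the topology of `X` on `E` suffice for the proof
(`HasTopologicalRepresentation.exists_code`): every sequence in `E` has a subsequence with range in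
`J`, and for any `a ∈ J` and any positive `b` (that is, `b ∉ J`), one of the countably many coding
sets misses `a` and meets `b` in a positive set.

The kernel of `b ⊆ E` is the set of points of `2^ω` all of whose neighbourhoods `V` contain the
image of a positive part `b ∩ f ⁻¹' V` of `b`.
The central lemma is `not_positiveKernel_subset`, a Baire category argument: the kernel of a positive
set is never covered by a countable set and countably many closures `closure (f '' c)` with `c ∈ J`.
In particular the kernel `P` of all of `E` is a nonempty perfect set.

The code `f` itself need not take its values in `P`, let alone have dense image in `2^ω`. It is
therefore followed by a map `φ : 2^ω → 2^ω` which reads a sequence at the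
places where the tree of `P` splits (`splittingDigits`). This `φ` is continuous, maps `P`
homeomorphically onto `2^ω`, and has countable image off `P`. Moving the points `φ (f e)` by smaller
and smaller amounts (`perturb`) gives an injective `ρ'`. Then `closure (ρ' '' c)` exceeds
`φ '' closure (f '' c)` by a countable set at most, and it contains the `φ`-image of the kernel of
`c`. Hence the closures `closure (ρ' '' c)`, `c ∈ J`, are nowhere dense, and countably many of them
together with a countable set never cover `closure (ρ' '' b)` for a positive `b`.
-/

open Filter Topology PiNat

/-! ### Countable codes for ideals with a topological representation -/

/-- A `J`-positive set stays positive on some member of `B` missing a prescribed set of `J`. -/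
def SeparatedBy {E : Type*} (J : Set (Set E)) (B : ℕ → Set E) : Prop :=
  ∀ a ∈ J, ∀ b ∉ J, ∃ n, Disjoint (B n) a ∧ b ∩ B n ∉ J

/-- Every sequence has a subsequence whose range belongs to `J`. -/
def SequentiallyTall {E : Type*} (J : Set (Set E)) : Prop :=
  ∀ u : ℕ → E, ∃ ψ : ℕ → ℕ, StrictMono ψ ∧ range (u ∘ ψ) ∈ J

theorem IsSetSigmaIdeal.mem_of_countable {S : Type*} {I : Set (Set S)} (hI : IsSetSigmaIdeal I)
    {A : Set S} (hA : A.Countable) : A ∈ I := by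
  rcases A.eq_empty_or_nonempty with rfl | hne
  · exact hI.empty_mem
  · obtain ⟨f, rfl⟩ := hA.exists_eq_range hne
    rw [← iUnion_singleton_eq_range]
    exact hI.iUnion_mem _ fun n => hI.singleton_mem _

theorem IsSetSigmaIdeal.union_mem {S : Type*} {I : Set (Set S)} (hI : IsSetSigmaIdeal I)
    {A B : Set S} (hA : A ∈ I) (hB : B ∈ I) : A ∪ B ∈ I := by
  have h := hI.iUnion_mem (fun n => if n = 0 then A else B) fun n => by
    split_ifs <;> assumption
  refine hI.mem_of_subset ?_ h
  rintro x (hx | hx)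
  · exact mem_iUnion.2 ⟨0, by simpa using hx⟩
  · exact mem_iUnion.2 ⟨1, by simpa using hx⟩

/-- Either the sequence has a convergent subsequence, or its range is closed. -/
theorem exists_strictMono_closure_range_countable {X : Type*} [TopologicalSpace X] [T2Space X]
    [FirstCountableTopology X] (u : ℕ → X) :
    ∃ ψ : ℕ → ℕ, StrictMono ψ ∧ (closure (range (u ∘ ψ))).Countable := by
  by_cases h : ∃ x, MapClusterPt x atTop u
  · obtain ⟨x, hx⟩ := h
    obtain ⟨ψ, hψ, hlim⟩ := hx.tendsto_subseq
    refine ⟨ψ, hψ, ((countable_range (u ∘ ψ)).insert x).mono ?_⟩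
    exact closure_minimal (subset_insert _ _) hlim.isCompact_insert_range.isClosed
  · refine ⟨id, strictMono_id, (countable_range u).mono fun x hx => ?_⟩
    by_contra hxu
    refine h ⟨x, mapClusterPt_iff_frequently.2 fun V hV => ?_⟩
    rw [frequently_atTop]
    intro N
    have hfin : IsClosed (u '' Iio N) := ((finite_Iio N).image u).isClosed
    have hN : V ∩ (u '' Iio N)ᶜ ∈ 𝓝 x := inter_mem hV (hfin.isOpen_compl.mem_nhds fun hx' =>
      hxu (image_subset_range _ _ hx'))
    obtain ⟨_, ⟨hyV, hyN⟩, n, rfl⟩ := mem_closure_iff_nhds.1 hx _ hN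
    exact ⟨n, not_lt.1 fun hn => hyN ⟨n, hn, rfl⟩, hyV⟩

/-- If `x` is in the closure of `ρ '' b` but not of `ρ '' a`, then it is in the closure of the part
of `ρ '' b` in some basic open set missing `a`. So if all these parts came from members of `J`, then
`closure (ρ '' b)` would be covered by countably many sets of the `σ`-ideal. -/
theorem HasTopologicalRepresentation.exists_code {E : Type u} {J : Set (Set E)}
    (hrep : HasTopologicalRepresentation.{v, u} J) :
    SequentiallyTall J ∧ ∃ B : ℕ → Set E, SeparatedBy J B := by
  obtain ⟨X, _, _, _, I, hI, D, -, -, ρ, hρ, hJ⟩ := hrep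
  have hmem : ∀ a : Set E, a ∈ J ↔ closure (ρ '' a) ∈ I := fun a => by
    rw [hJ]
    exact ⟨fun h => h.2, fun h => ⟨image_subset_iff.2 fun e _ => hρ.mapsTo (mem_univ e), h⟩⟩
  let := TopologicalSpace.metrizableSpaceMetric X
  have : SecondCountableTopology X := UniformSpace.secondCountable_of_separable X
  refine ⟨fun u => ?_, ?_⟩
  · obtain ⟨ψ, hψ, hc⟩ := exists_strictMono_closure_range_countable (ρ ∘ u)
    refine ⟨ψ, hψ, (hmem _).2 (hI.mem_of_countable ?_)⟩
    rwa [← range_comp]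
  · classical
    obtain ⟨U, hUc, -, hUb⟩ := TopologicalSpace.exists_countable_basis X
    obtain ⟨W, hW⟩ := (hUc.insert ∅).exists_eq_range (insert_nonempty _ _)
    refine ⟨fun n => ρ ⁻¹' W n, fun a ha b hb => ?_⟩
    by_contra! hcon
    apply hb
    rw [hmem] at ha ⊢
    -- The value `∅` at indices whose basic open set meets `a` keeps the union indexed by `ℕ`.
    have hsmall : ∀ n, (if Disjoint (ρ ⁻¹' W n) a then closure (ρ '' (b ∩ ρ ⁻¹' W n)) else ∅) ∈ I :=
      fun n => by
        split_ifs with h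
        · exact (hmem _).1 (hcon n h)
        · exact hI.empty_mem
    refine hI.mem_of_subset (fun x hx => ?_) (hI.union_mem ha (hI.iUnion_mem _ hsmall))
    by_cases hxa : x ∈ closure (ρ '' a)
    · exact Or.inl hxa
    obtain ⟨V, hV, hxV, hVa⟩ := hUb.exists_subset_of_mem_open
      (show x ∈ (closure (ρ '' a))ᶜ from hxa) isClosed_closure.isOpen_compl
    obtain ⟨n, rfl⟩ : V ∈ range W := hW ▸ mem_insert_of_mem _ hV
    have hdisj : Disjoint (ρ ⁻¹' W n) a := disjoint_left.2 fun e he hea =>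
      hVa he (subset_closure (mem_image_of_mem ρ hea))
    refine Or.inr (mem_iUnion.2 ⟨n, ?_⟩)
    rw [if_pos hdisj, mem_closure_iff_nhds]
    intro N hN
    obtain ⟨_, ⟨hyN, hyW⟩, e, he, rfl⟩ := mem_closure_iff_nhds.1 hx _
      (inter_mem hN ((hUb.isOpen hV).mem_nhds hxV))
    exact ⟨ρ e, hyN, e, ⟨he, hyW⟩, rfl⟩

/-! ### Positive kernels -/

/-- The points of `Y` such that, for each neighbourhood `V`, the part of `b` that `f` sends into `V`
is `J`-positive, that is, not in `J`. -/
def positiveKernel {E Y : Type*} [TopologicalSpace Y] (J : Set (Set E)) (f : E → Y) (b : Set E) :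
    Set Y :=
  {x | ∀ V ∈ 𝓝 x, b ∩ f ⁻¹' V ∉ J}

section Kernel

variable {E Y : Type*} [TopologicalSpace Y] {J : Set (Set E)} {f : E → Y}

theorem IsSetIdeal.biUnion_mem (hJ : IsSetIdeal J) {ι : Type*} (t : Finset ι) (s : ι → Set E)
    (h : ∀ i ∈ t, s i ∈ J) : (⋃ i ∈ t, s i) ∈ J := by
  classical
  induction t using Finset.induction_on with
  | empty => simpa using hJ.empty_mem
  | insert i t hi ih =>
    rw [Finset.set_biUnion_insert]
    exact hJ.union_mem (h i (t.mem_insert_self i))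
      (ih fun j hj => h j (Finset.mem_insert_of_mem hj))

theorem positiveKernel_mono (hJ : IsSetIdeal J) {a b : Set E} (h : a ⊆ b) :
    positiveKernel J f a ⊆ positiveKernel J f b := fun _ hx V hV hb =>
  hx V hV (hJ.mem_of_subset (inter_subset_inter_left _ h) hb)

theorem positiveKernel_inter_subset (hJ : IsSetIdeal J) {b : Set E} {C : Set Y} (hC : IsClosed C) :
    positiveKernel J f (b ∩ f ⁻¹' C) ⊆ C := by
  intro x hx
  by_contra hxC
  refine hx _ (hC.isOpen_compl.mem_nhds hxC) (hJ.mem_of_subset ?_ hJ.empty_mem)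
  rintro e ⟨⟨-, h⟩, h'⟩
  exact h' h

theorem isClosed_positiveKernel (b : Set E) : IsClosed (positiveKernel J f b) := by
  rw [← isOpen_compl_iff, isOpen_iff_mem_nhds]
  intro x hx
  simp only [positiveKernel, mem_compl_iff, mem_ofPred_eq, not_forall, not_not] at hx
  obtain ⟨V, hV, hVJ⟩ := hx
  filter_upwards [eventually_mem_nhds_iff.2 hV] with y hy hyk
  exact hyk V hy hVJ

theorem positiveKernel_nonempty [CompactSpace Y] (hJ : IsSetIdeal J) {b : Set E} (hb : b ∉ J) :
    (positiveKernel J f b).Nonempty := by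
  by_contra hne
  have h : ∀ x : Y, ∃ V ∈ 𝓝 x, b ∩ f ⁻¹' V ∈ J := by
    intro x
    by_contra! hx
    exact hne ⟨x, hx⟩
  choose V hV hVJ using h
  obtain ⟨t, -, ht⟩ := isCompact_univ.elim_nhds_subcover V fun x _ => hV x
  refine hb (hJ.mem_of_subset (fun e he => ?_) (hJ.biUnion_mem t _ fun x _ => hVJ x))
  obtain ⟨x, hx, hex⟩ := mem_iUnion₂.1 (ht (mem_univ (f e)))
  exact mem_iUnion₂.2 ⟨x, hx, he, hex⟩

theorem exists_mem_closure_image_of_mem_positiveKernel [FirstCountableTopology Y]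
    (hJ : IsSetIdeal J) (htall : SequentiallyTall J) {b : Set E} {x : Y}
    (hx : x ∈ positiveKernel J f b) : ∃ c ∈ J, x ∈ closure (f '' c) := by
  obtain ⟨V, hV⟩ := (𝓝 x).exists_antitone_basis
  have hne : ∀ n, (b ∩ f ⁻¹' V n).Nonempty := fun n => by
    rw [nonempty_iff_ne_empty]
    intro h
    exact hx _ (hV.mem n) (h ▸ hJ.empty_mem)
  choose w hw using hne
  obtain ⟨ψ, hψ, hc⟩ := htall w
  refine ⟨_, hc, mem_closure_of_tendsto
    ((hV.tendsto fun n => (hw n).2).comp hψ.tendsto_atTop) (Eventually.of_forall fun n => ?_)⟩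
  exact mem_image_of_mem f ⟨n, rfl⟩

/-- The Baire category argument: if the kernel of a positive set were so covered, a relatively open
part of it would lie in a single closure `closure (f '' c)`, and separating `c` from the
corresponding part of `b` would produce a point of the kernel outside that closure. -/
theorem not_positiveKernel_subset [CompactSpace Y] [T2Space Y] [FirstCountableTopology Y]
    (hJ : IsSetIdeal J) (htall : SequentiallyTall J) {B : ℕ → Set E} (hsep : SeparatedBy J B)
    (hB : ∀ n, ∃ U : Set Y, IsClopen U ∧ f ⁻¹' U = B n) {b : Set E} (hb : b ∉ J) {Z : Set Y}
    (hZ : Z.Countable) {C : Set (Set E)} (hC : C.Countable) (hCJ : C ⊆ J) :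
    ¬ positiveKernel J f b ⊆ Z ∪ ⋃ c ∈ C, closure (f '' c) := by
  intro hcov
  -- Points of the kernel are limits of members of `J`, so `Z` can be absorbed into `C`.
  have hpt : ∀ z : Y, ∃ c ∈ J, z ∈ positiveKernel J f b → z ∈ closure (f '' c) := by
    intro z
    by_cases hz : z ∈ positiveKernel J f b
    · obtain ⟨c, hc, hzc⟩ := exists_mem_closure_image_of_mem_positiveKernel hJ htall hz
      exact ⟨c, hc, fun _ => hzc⟩
    · exact ⟨∅, hJ.empty_mem, fun h => absurd h hz⟩
  choose p hpJ hp using hpt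
  have hC' : (C ∪ p '' Z).Countable := hC.union (hZ.image p)
  have : Countable ↥(C ∪ p '' Z) := hC'.to_subtype
  have : CompactSpace (positiveKernel J f b) :=
    isCompact_iff_compactSpace.1 (isClosed_positiveKernel b).isCompact
  have : Nonempty (positiveKernel J f b) := (positiveKernel_nonempty hJ hb).to_subtype
  obtain ⟨⟨c, hc⟩, ⟨x, hxk⟩, hx⟩ := nonempty_interior_of_iUnion_of_closed
    (f := fun c : ↥(C ∪ p '' Z) =>
      ((↑) : positiveKernel J f b → Y) ⁻¹' closure (f '' (c : Set E)))
    (fun c => isClosed_closure.preimage continuous_subtype_val) (by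
      refine eq_univ_of_forall fun ⟨z, hz⟩ => mem_iUnion.2 ?_
      rcases hcov hz with h | h
      · exact ⟨⟨p z, Or.inr ⟨z, h, rfl⟩⟩, hp z hz⟩
      · obtain ⟨c, hc, hzc⟩ := mem_iUnion₂.1 h
        exact ⟨⟨c, Or.inl hc⟩, hzc⟩)
  have hcJ : c ∈ J := by
    rcases hc with hc | ⟨z, -, rfl⟩
    exacts [hCJ hc, hpJ z]
  obtain ⟨V, hV, hVc⟩ := mem_nhds_induced _ _ _ |>.1 (mem_interior_iff_mem_nhds.1 hx)
  obtain ⟨W, ⟨hWx, hWcl⟩, hWV⟩ := (closed_nhds_basis x).mem_iff.1 hV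
  obtain ⟨n, hdisj, hn⟩ := hsep c hcJ _ (hxk W hWx)
  obtain ⟨U, hU, hUB⟩ := hB n
  have hpos : b ∩ f ⁻¹' (W ∩ U) ∉ J := by
    rwa [preimage_inter, hUB, ← inter_assoc]
  obtain ⟨y, hy⟩ := positiveKernel_nonempty (f := f) hJ hpos
  have hyWU := positiveKernel_inter_subset hJ (hWcl.inter hU.isClosed) hy
  have hyc : y ∈ closure (f '' c) :=
    @hVc ⟨y, positiveKernel_mono hJ inter_subset_left hy⟩ (hWV hyWU.1)
  obtain ⟨_, hzU, e, he, rfl⟩ := mem_closure_iff_nhds.1 hyc U (hU.isOpen.mem_nhds hyWU.2)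
  exact disjoint_left.1 hdisj (hUB ▸ hzU) he

end Kernel

/-! ### Collapsing the Cantor space onto a perfect subset -/

theorem exists_cylinder_subset {x : ℕ → Bool} {V : Set (ℕ → Bool)} (hV : V ∈ 𝓝 x) :
    ∃ n, cylinder x n ⊆ V := by
  obtain ⟨_, ⟨y, n, rfl⟩, hx, hsub⟩ :=
    (isTopologicalBasis_cylinders (fun _ : ℕ => Bool)).mem_nhds_iff.1 hV
  exact ⟨n, (mem_cylinder_iff_eq.1 hx).symm ▸ hsub⟩

theorem cylinder_mem_nhds (x : ℕ → Bool) (n : ℕ) : cylinder x n ∈ 𝓝 x :=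
  (isOpen_cylinder _ x n).mem_nhds (self_mem_cylinder x n)

/-- The first `k` digits of `x` have extensions in `P` with both possible values of digit `k`. -/
def SplitsAt (P : Set (ℕ → Bool)) (x : ℕ → Bool) (k : ℕ) : Prop :=
  ∀ v : Bool, ∃ y ∈ P, y ∈ cylinder x k ∧ y k = v

open Classical in
/-- The sequence of digits of `x` at the places where the tree of `P` splits along `x`. If there
are only finitely many of these, which for perfect `P` means `x ∉ P`, the rest is filled with
`false`. -/
noncomputable def splittingDigits (P : Set (ℕ → Bool)) (x : ℕ → Bool) (n : ℕ) : Bool :=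
  decide (∃ k, SplitsAt P x k ∧ Nat.count (SplitsAt P x) k = n ∧ x k = true)

section Splitting

variable {P : Set (ℕ → Bool)} {x y : ℕ → Bool}

theorem splitsAt_congr {k : ℕ} (h : y ∈ cylinder x k) : SplitsAt P y k ↔ SplitsAt P x k := by
  simp only [SplitsAt, mem_cylinder_iff_eq.1 h]

open Classical in
theorem count_splitsAt_congr {k : ℕ} (h : y ∈ cylinder x k) :
    Nat.count (SplitsAt P y) k = Nat.count (SplitsAt P x) k := by
  have hlt : ∀ i < k, (SplitsAt P y i ↔ SplitsAt P x i) := fun i hi =>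
    splitsAt_congr (cylinder_anti x hi.le h)
  exact le_antisymm (Nat.count_mono_left fun i hi => (hlt i hi).1)
    (Nat.count_mono_left fun i hi => (hlt i hi).2)

open Classical in
/-- A sequence has at most one splitting place with a given count, so the existential quantifier in
`splittingDigits` does read off a digit. -/
theorem splittingDigits_count {k : ℕ} (h : SplitsAt P x k) :
    splittingDigits P x (Nat.count (SplitsAt P x) k) = x k := by
  rw [splittingDigits, Bool.eq_iff_iff, decide_eq_true_iff]
  refine ⟨?_, fun hk => ⟨k, h, rfl, hk⟩⟩
  rintro ⟨j, hj, hjk, hxj⟩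
  rwa [← Nat.count_injective hj h hjk]

open Classical in
theorem splittingDigits_congr {k : ℕ} (h : SplitsAt P x k) (hy : y ∈ cylinder x k) :
    splittingDigits P y (Nat.count (SplitsAt P x) k) = y k := by
  rw [← count_splitsAt_congr hy, splittingDigits_count ((splitsAt_congr hy).2 h)]

theorem splitsAt_firstDiff (hx : x ∈ P) (hy : y ∈ P) (hne : x ≠ y) :
    SplitsAt P x (firstDiff x y) := by
  intro v
  by_cases hv : x (firstDiff x y) = v
  · exact ⟨x, hx, self_mem_cylinder _ _, hv⟩
  · refine ⟨y, hy, fun i hi => (apply_eq_of_lt_firstDiff hi).symm, ?_⟩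
    have := apply_firstDiff_ne hne
    revert this hv
    cases x (firstDiff x y) <;> cases y (firstDiff x y) <;> cases v <;> simp

theorem injOn_splittingDigits : InjOn (splittingDigits P) P := by
  classical
  intro x hx y hy hxy
  by_contra hne
  have hs := splitsAt_firstDiff hx hy hne
  apply apply_firstDiff_ne hne
  rw [← splittingDigits_count hs, hxy]
  exact splittingDigits_congr hs fun i hi => (apply_eq_of_lt_firstDiff hi).symm

open Classical in
theorem exists_splitsAt_count_eq (hperf : ∀ x ∈ P, ∀ n, ∃ y ∈ P, y ∈ cylinder x n ∧ y ≠ x)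
    (hx : x ∈ P) (n : ℕ) : ∃ k, SplitsAt P x k ∧ Nat.count (SplitsAt P x) k = n := by
  have hinf : {k | SplitsAt P x k}.Infinite := by
    refine infinite_of_forall_exists_gt fun n => ?_
    obtain ⟨y, hy, hyn, hne⟩ := hperf x hx (n + 1)
    refine ⟨firstDiff x y, splitsAt_firstDiff hx hy hne.symm, ?_⟩
    have := (mem_cylinder_iff_le_firstDiff hne (n + 1)).1 hyn
    rw [firstDiff_comm]
    exact this
  exact ⟨_, Nat.nth_mem_of_infinite hinf n, Nat.count_nth_of_infinite hinf n⟩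

/-- A cylinder missing `P` contains no branch that splits further. -/
theorem exists_forall_splitsAt_lt (hP : IsClosed P) (hx : x ∉ P) :
    ∃ N, ∀ y ∈ cylinder x N, ∀ k, SplitsAt P y k → k < N := by
  obtain ⟨N, hN⟩ := exists_cylinder_subset (hP.isOpen_compl.mem_nhds hx)
  refine ⟨N, fun y hy k hk => not_le.1 fun hNk => ?_⟩
  obtain ⟨z, hz, hzy, -⟩ := hk true
  refine hN ?_ hz
  rw [← mem_cylinder_iff_eq.1 hy]
  exact cylinder_anti y hNk hzy

theorem continuous_splittingDigits (hP : IsClosed P)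
    (hperf : ∀ x ∈ P, ∀ n, ∃ y ∈ P, y ∈ cylinder x n ∧ y ≠ x) :
    Continuous (splittingDigits P) := by
  classical
  refine continuous_pi fun n => continuous_iff_continuousAt.2 fun x => ?_
  suffices h : ∃ N, ∀ y ∈ cylinder x N, splittingDigits P y n = splittingDigits P x n by
    obtain ⟨N, hN⟩ := h
    exact (continuousAt_const (y := splittingDigits P x n)).congr
      (mem_of_superset (cylinder_mem_nhds x N) fun y hy => (hN y hy).symm)
  by_cases hx : x ∈ P
  · obtain ⟨k, hk, rfl⟩ := exists_splitsAt_count_eq hperf hx n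
    refine ⟨k + 1, fun y hy => ?_⟩
    rw [splittingDigits_count hk, splittingDigits_congr hk (cylinder_anti x k.le_succ hy)]
    exact hy k k.lt_succ_self
  · -- Off `P` the splitting places are bounded, so they are the same at all points near `x`.
    obtain ⟨N, hN⟩ := exists_forall_splitsAt_lt hP hx
    refine ⟨N, fun y hy => ?_⟩
    simp only [splittingDigits]
    congr 1
    refine propext (exists_congr fun k => ?_)
    by_cases hk : k < N
    · have hyk := cylinder_anti x hk.le hy
      rw [splitsAt_congr hyk, count_splitsAt_congr hyk, hy k hk]
    · exact iff_of_false (fun h => hk (hN y hy k h.1))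
        (fun h => hk (hN x (self_mem_cylinder x N) k h.1))

theorem image_splittingDigits (hP : IsClosed P) (hne : P.Nonempty)
    (hperf : ∀ x ∈ P, ∀ n, ∃ y ∈ P, y ∈ cylinder x n ∧ y ≠ x) :
    splittingDigits P '' P = univ := by
  classical
  have hcl : IsClosed (splittingDigits P '' P) :=
    (hP.isCompact.image (continuous_splittingDigits hP hperf)).isClosed
  refine eq_univ_of_forall fun z => ?_
  rw [← hcl.closure_eq, mem_closure_iff_nhds]
  have key : ∀ n, ∃ x ∈ P, splittingDigits P x ∈ cylinder z n := by
    intro n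
    induction n with
    | zero => obtain ⟨x, hx⟩ := hne; exact ⟨x, hx, by simp⟩
    | succ n ih =>
      obtain ⟨x, hx, hxz⟩ := ih
      obtain ⟨k, hk, hkn⟩ := exists_splitsAt_count_eq hperf hx n
      obtain ⟨y, hy, hyx, hyk⟩ := hk (z n)
      refine ⟨y, hy, fun i hi => ?_⟩
      rcases Nat.lt_succ_iff_lt_or_eq.1 hi with hi | rfl
      · -- The first `n` splitting digits only depend on the digits before `k`.
        obtain ⟨j, hj, rfl⟩ := exists_splitsAt_count_eq hperf hx i
        have hjk : j < k := Nat.lt_of_count_lt_count (p := SplitsAt P x) (hkn ▸ hi)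
        rw [← hxz _ hi, splittingDigits_count hj,
          splittingDigits_congr hj (cylinder_anti x hjk.le hyx)]
        exact hyx j hjk
      · rw [← hkn, splittingDigits_congr hk hyx, hkn, hyk]
  intro V hV
  obtain ⟨n, hn⟩ := exists_cylinder_subset hV
  obtain ⟨x, hx, hxz⟩ := key n
  exact ⟨_, hn hxz, mem_image_of_mem _ hx⟩

/-- Off `P`, the sequence of splitting digits is eventually `false`. -/
theorem countable_splittingDigits_compl (hP : IsClosed P) :
    (splittingDigits P '' Pᶜ).Countable := by
  classical
  refine (countable_range fun (s : Finset ℕ) (n : ℕ) => decide (n ∈ s)).mono ?_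
  rintro _ ⟨x, hx, rfl⟩
  obtain ⟨N, hN⟩ := exists_forall_splitsAt_lt hP hx
  refine ⟨(Finset.range N).filter fun n => splittingDigits P x n = true, funext fun n => ?_⟩
  rw [Bool.eq_iff_iff, decide_eq_true_iff, Finset.mem_filter, Finset.mem_range,
    and_iff_right_iff_imp]
  intro hn
  simp only [splittingDigits, decide_eq_true_iff] at hn
  obtain ⟨k, hk, rfl, -⟩ := hn
  exact (Nat.count_le _).trans_lt (hN x (self_mem_cylinder x N) k hk)

end Splitting

/-! ### Small perturbations -/

/-- Keep the first `enc e` digits of `q e` and let the remaining ones spell out the number `enc e`,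
each number being marked by its own infinite set of places. -/
def perturb {E : Type*} (enc : E → ℕ) (q : E → ℕ → Bool) (e : E) (i : ℕ) : Bool :=
  if i < enc e then q e i else decide (i.unpair.2 = enc e)

section Perturb

variable {E : Type*} {enc : E → ℕ} {q : E → ℕ → Bool}

theorem perturb_mem_cylinder (e : E) : perturb enc q e ∈ cylinder (q e) (enc e) := fun _ hi =>
  if_pos hi

theorem perturb_injective (henc : Function.Injective enc) :
    Function.Injective (perturb enc q) := by
  intro e e' h
  have hi := congrFun h (Nat.pair (max (enc e) (enc e')) (enc e))
  have hle := Nat.left_le_pair (max (enc e) (enc e')) (enc e)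
  rw [perturb, perturb, if_neg (not_lt.2 ((le_max_left _ _).trans hle)),
    if_neg (not_lt.2 ((le_max_right _ _).trans hle))] at hi
  simp only [Nat.unpair_pair, decide_true] at hi
  exact henc (of_decide_eq_true hi.symm)

/-- Only finitely many points are moved before a given digit, so `perturb` creates no new
accumulation points. -/
theorem closure_perturb_subset (henc : Function.Injective enc) (c : Set E) :
    closure (perturb enc q '' c) ⊆ perturb enc q '' c ∪ closure (q '' c) := by
  intro x hx
  by_cases hxc : x ∈ perturb enc q '' c
  · exact Or.inl hxc
  refine Or.inr (mem_closure_iff_nhds.2 fun V hV => ?_)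
  obtain ⟨n, hn⟩ := exists_cylinder_subset hV
  have hfin : {e | e ∈ c ∧ enc e < n}.Finite :=
    ((finite_Iio n).preimage henc.injOn).subset fun e he => he.2
  have hcl : IsClosed (perturb enc q '' {e | e ∈ c ∧ enc e < n}) := (hfin.image _).isClosed
  obtain ⟨_, ⟨hy, hyn⟩, e, he, rfl⟩ := mem_closure_iff_nhds.1 hx _ (inter_mem
    (cylinder_mem_nhds x n) (hcl.isOpen_compl.mem_nhds fun h =>
      hxc (image_mono (fun e he => he.1) h)))
  have hen : n ≤ enc e := not_lt.1 fun h => hyn ⟨e, ⟨he, h⟩, rfl⟩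
  refine ⟨q e, hn fun i hi => ?_, e, he, rfl⟩
  rw [← hy i hi, perturb_mem_cylinder e i (hi.trans_le hen)]

end Perturb

/-! ### The generated `σ`-ideal and the representation -/

theorem exists_cover_of_mem_generatedSigmaIdeal {E S : Type*} {J : Set (Set E)} {g : Set E → Set S}
    {A : Set S} (hA : A ∈ generatedSigmaIdeal (g '' J)) :
    ∃ Z : Set S, Z.Countable ∧ ∃ C ⊆ J, C.Countable ∧ A ⊆ Z ∪ ⋃ c ∈ C, g c := by
  refine hA {A | ∃ Z : Set S, Z.Countable ∧ ∃ C ⊆ J, C.Countable ∧ A ⊆ Z ∪ ⋃ c ∈ C, g c}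
    ⟨?_, ?_, ?_, ?_⟩ ?_
  · exact ⟨∅, countable_empty, ∅, empty_subset _, countable_empty, empty_subset _⟩
  · rintro A B hAB ⟨Z, hZ, C, hCJ, hC, hB⟩
    exact ⟨Z, hZ, C, hCJ, hC, hAB.trans hB⟩
  · intro A hA
    choose Z hZ C hCJ hC hAC using hA
    refine ⟨⋃ n, Z n, countable_iUnion hZ, ⋃ n, C n, iUnion_subset hCJ, countable_iUnion hC,
      iUnion_subset fun n x hx => ?_⟩
    rcases hAC n hx with h | h
    · exact Or.inl (mem_iUnion.2 ⟨n, h⟩)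
    · obtain ⟨c, hc, hxc⟩ := mem_iUnion₂.1 h
      exact Or.inr (mem_iUnion₂.2 ⟨c, mem_iUnion.2 ⟨n, hc⟩, hxc⟩)
  · intro s
    exact ⟨{s}, countable_singleton s, ∅, empty_subset _, countable_empty, subset_union_left⟩
  · rintro _ ⟨c, hc, rfl⟩
    refine ⟨∅, countable_empty, {c}, singleton_subset_iff.2 hc, countable_singleton c, ?_⟩
    simp

theorem theorem1p3 {E : Type u} [Countable E] (J : Set (Set E))
    (hJ : IsSetIdeal J) (hproper : univ ∉ J)
    (hrep : HasTopologicalRepresentation.{v, u} J) :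
    ∃ F : Set (Set (ℕ → Bool)),
      (∀ K ∈ F, IsCompact K ∧ IsNowhereDense K) ∧
        IsRepresentedBy J (generatedSigmaIdeal F) := by
  classical
  obtain ⟨htall, B, hsep⟩ := hrep.exists_code
  obtain ⟨enc, henc⟩ := exists_injective_nat E
  let f : E → ℕ → Bool := fun e n => decide (e ∈ B n)
  have hB : ∀ n, ∃ U : Set (ℕ → Bool), IsClopen U ∧ f ⁻¹' U = B n := fun n =>
    ⟨(fun x : ℕ → Bool => x n) ⁻¹' {true},
      (isClopen_discrete _).preimage (continuous_apply n), by ext e; simp [f]⟩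
  have hbaire := fun {b : Set E} (hb : b ∉ J) {Z : Set (ℕ → Bool)} (hZ : Z.Countable)
    {C : Set (Set E)} (hC : C.Countable) (hCJ : C ⊆ J) =>
      not_positiveKernel_subset (f := f) hJ htall hsep hB hb hZ hC hCJ
  set P := positiveKernel J f univ
  have hPcl : IsClosed P := isClosed_positiveKernel univ
  have hPne : P.Nonempty := positiveKernel_nonempty hJ hproper
  have hkerP : ∀ b, positiveKernel J f b ⊆ P := fun b => positiveKernel_mono hJ (subset_univ b)
  -- An isolated point of `P` would be the whole kernel of a positive set.
  have hperf : ∀ x ∈ P, ∀ n, ∃ y ∈ P, y ∈ cylinder x n ∧ y ≠ x := by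
    intro x hx n
    by_contra! hcon
    refine hbaire (hx _ (cylinder_mem_nhds x n)) (countable_singleton x) countable_empty
      (empty_subset _) fun y hy => Or.inl (hcon y (hkerP _ hy) ?_)
    refine positiveKernel_inter_subset hJ ?_ hy
    rw [cylinder_eq_pi]
    exact isClosed_set_pi fun _ _ => isClosed_discrete _
  let φ := splittingDigits P
  have hφ : Continuous φ := continuous_splittingDigits hPcl hperf
  let ρ := perturb enc (φ ∘ f)
  have hρ : Function.Injective ρ := perturb_injective henc
  have hclosure : ∀ c : Set E, closure (ρ '' c) ⊆ ρ '' c ∪ φ '' closure (f '' c) := fun c =>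
    (closure_perturb_subset henc c).trans (union_subset_union_right _ (by
      rw [image_comp]
      exact closure_minimal (image_mono subset_closure)
        (isClosed_closure.isCompact.image hφ).isClosed))
  have hker : ∀ b : Set E, φ '' positiveKernel J f b ⊆ closure (ρ '' b) := by
    rintro b _ ⟨x, hx, rfl⟩
    rw [mem_closure_iff_nhds]
    intro V hV
    obtain ⟨n, hn⟩ := exists_cylinder_subset hV
    have hpos := hx _ (hφ.continuousAt (cylinder_mem_nhds (φ x) n))
    -- A positive set is infinite, so it has an element that is moved only beyond digit `n`.
    obtain ⟨e, ⟨heb, hex⟩, hen⟩ : ∃ e ∈ b ∩ f ⁻¹' (φ ⁻¹' cylinder (φ x) n), n ≤ enc e := by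
      by_contra! hcon
      have hfin : (b ∩ f ⁻¹' (φ ⁻¹' cylinder (φ x) n)).Finite :=
        ((finite_Iio n).preimage henc.injOn).subset hcon
      refine hpos (hJ.mem_of_subset (fun e he => ?_)
        (hJ.biUnion_mem hfin.toFinset (fun e => {e}) fun e _ => hJ.singleton_mem e))
      exact mem_iUnion₂.2 ⟨e, hfin.mem_toFinset.2 he, rfl⟩
    refine ⟨ρ e, hn fun i hi => ?_, e, heb, rfl⟩
    rw [← hex i hi]
    exact perturb_mem_cylinder e i (hi.trans_le hen)
  -- Pull a cover back along `φ`, which is injective on `P`; what comes from outside `P` is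
  -- countable, and so is the preimage of `range ρ`.
  have hcover : ∀ b ∉ J, ∀ Z : Set (ℕ → Bool), Z.Countable → ∀ C : Set (Set E), C.Countable →
      C ⊆ J → ¬ φ '' positiveKernel J f b ⊆ Z ∪ ⋃ c ∈ C, closure (ρ '' c) := by
    intro b hb Z hZ C hC hCJ hsub
    have hQ : (Z ∪ range ρ ∪ φ '' Pᶜ).Countable :=
      (hZ.union (countable_range ρ)).union (countable_splittingDigits_compl hPcl)
    refine hbaire hb (Z := P ∩ φ ⁻¹' (Z ∪ range ρ ∪ φ '' Pᶜ)) ?_ hC hCJ fun x hx => ?_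
    · refine MapsTo.countable_of_injOn (f := φ) (fun x hx => hx.2)
        (injOn_splittingDigits.mono inter_subset_left) hQ
    · have hxP := hkerP b hx
      rcases hsub ⟨x, hx, rfl⟩ with h | h
      · exact Or.inl ⟨hxP, Or.inl (Or.inl h)⟩
      obtain ⟨c, hc, hxc⟩ := mem_iUnion₂.1 h
      rcases hclosure c hxc with h | ⟨y, hy, hyx⟩
      · exact Or.inl ⟨hxP, Or.inl (Or.inr (image_subset_range _ _ h))⟩
      by_cases hyP : y ∈ P
      · rw [injOn_splittingDigits hyP hxP hyx] at hy
        exact Or.inr (mem_iUnion₂.2 ⟨c, hc, hy⟩)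
      · exact Or.inl ⟨hxP, Or.inr ⟨y, hyP, hyx⟩⟩
  -- The generating family consists of the closures of the images of the members of `J`.
  refine ⟨(fun c => closure (ρ '' c)) '' J, ?_, isSetSigmaIdeal_generatedSigmaIdeal _, range ρ,
    countable_range ρ, ?_, ρ, ⟨fun e _ => mem_range_self e, hρ.injOn, by
      rw [SurjOn, image_univ]⟩, ?_⟩
  · rintro _ ⟨c, hc, rfl⟩
    refine ⟨isClosed_closure.isCompact, ?_⟩
    rw [isClosed_closure.isNowhereDense_iff]
    by_contra hint
    obtain ⟨z, hz⟩ := nonempty_iff_ne_empty.2 hint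
    obtain ⟨W, ⟨hW, hWcl⟩, hWc⟩ := (closed_nhds_basis z).mem_iff.1 (mem_interior_iff_mem_nhds.1 hz)
    obtain ⟨x, hx, rfl⟩ : z ∈ φ '' P :=
      image_splittingDigits hPcl hPne hperf ▸ mem_univ z
    refine hcover _ (hx _ (hφ.continuousAt hW)) ∅ countable_empty {c} (countable_singleton c)
      (singleton_subset_iff.2 hc) ?_
    -- The kernel of the part of `E` sent into `W` by `φ ∘ f` has its `φ`-image inside `W`.
    rintro _ ⟨y, hy, rfl⟩
    have hyW : φ y ∈ W := positiveKernel_inter_subset hJ (hWcl.preimage hφ) hy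
    exact Or.inr (mem_iUnion₂.2 ⟨c, rfl, hWc hyW⟩)
  · rw [dense_iff_closure_eq, ← univ_subset_iff, ← image_univ,
      ← image_splittingDigits hPcl hPne hperf]
    exact hker univ
  · ext a
    refine ⟨fun ha => ⟨image_subset_range _ _, fun I _ hF => hF ⟨a, ha, rfl⟩⟩, fun ha => ?_⟩
    by_contra hna
    obtain ⟨Z, hZ, C, hCJ, hC, hcov⟩ := exists_cover_of_mem_generatedSigmaIdeal ha.2
    exact hcover a hna Z hZ C hC hCJ ((hker a).trans hcov)
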